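/- A \emph{chain graph} is a bipartite graph that is the intersection graph of rightward rays (representing the vertices of one side) and points (representing the vertices of the other side) on the real line. For $d\ge 1$, let $\mathrm{Chain}^d$ be the class of bipartite graphs $G=(U\cup V,E)$ that are the intersection of $d$ chain graphs with the same sides $U$ and $V$ (edge sets are intersected); these are the bipartite graphs of Ferrers dimension at most $d$. Let $Z_{\mathrm{Chain}^d}(n;k)$ be the maximum number of edges of a bipartite graph $G=(U\cup V,E)\in \mathrm{Chain}^d$ with $|U|=|V|=n$ that does not contain $K_{k,k}$ as a subgraph. Theorem 1 (Dichotomy theorem). (i) For all integers $k\ge 1$ and $n\ge 0$, $$Z_{\mathrm{Chain}^3}(n;k)\le 9n(k-1).$$ (ii) For all $k\ge 2$, $$Z_{\mathrm{Chain}^4}(n;k)\in\Omega\left(nk\cdot\frac{\log n}{\log\log n}\right)\quad\text{as } n\to\infty,$$ with an absolute implied constant: there is $c>0$ such that for every $k\ge 2$ there is $n_0(k)$ with $Z_{\mathrm{Chain}^4}(n;k)\ge c\,nk\,\frac{\log n}{\log\log n}$ for all $n\ge n_0(k)$. -/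

import Mathlib

/-- A bipartite graph `(U ∪ V, E)` is a simple graph on `U ⊕ V` all of whose edges join `U` to `V`.
It is a chain graph if it is the intersection graph of rightward rays `[r u, ∞)`, for `u` in `U`,
and points `p v`, for `v` in `V`, on the real line. -/
def IsChainGraph {U V : Type*} (G : SimpleGraph (U ⊕ V)) : Prop :=
  G ≤ completeBipartiteGraph U V ∧
    ∃ (r : U → ℝ) (p : V → ℝ), ∀ (u : U) (v : V),
      G.Adj (Sum.inl u) (Sum.inr v) ↔ (Set.Ici (r u) ∩ {p v}).Nonempty

/-- The class of intersections of `d` chain graphs on the same vertex set (for `d ≥ 1`), that is,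
of the bipartite graphs of Ferrers dimension at most `d`. -/
def IsChainPow {U V : Type*} (d : ℕ) (G : SimpleGraph (U ⊕ V)) : Prop :=
  ∃ H : Fin d → SimpleGraph (U ⊕ V), (∀ i, IsChainGraph (H i)) ∧ G = ⨅ i, H i

/-- The possible numbers of edges of a bipartite graph with parts of sizes `n` and `m` that is an
intersection of `d` chain graphs and has no subgraph isomorphic to `K_{k,k}`. -/
def chainEdgeCounts (d n m k : ℕ) : Set ℕ :=
  {e | ∃ G : SimpleGraph (Fin n ⊕ Fin m), IsChainPow d G ∧
    (completeBipartiteGraph (Fin k) (Fin k)).Free G ∧ G.edgeSet.ncard = e}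

/-- The Zarankiewicz number of the class of intersections of `d` chain graphs: the maximum number
of edges of a `K_{k,k}`-free graph in the class with parts of sizes `n` and `m`. -/
noncomputable def chainZarankiewicz (d n m k : ℕ) : ℕ :=
  sSup (chainEdgeCounts d n m k)

/-- The supremum in the definition of `chainZarankiewicz` is a maximum. -/
theorem chainZarankiewicz_isGreatest {d k : ℕ} (hd : 1 ≤ d) (hk : 1 ≤ k) (n m : ℕ) :
    IsGreatest (chainEdgeCounts d n m k) (chainZarankiewicz d n m k) := by
  have hfin : (chainEdgeCounts d n m k).Finite := by
    refine (Set.finite_range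
      (fun G : SimpleGraph (Fin n ⊕ Fin m) => G.edgeSet.ncard)).subset ?_
    rintro e ⟨G, -, -, rfl⟩
    exact ⟨G, rfl⟩
  have hne : (chainEdgeCounts d n m k).Nonempty := by
    refine ⟨_, ⊥, ⟨fun _ => ⊥, fun _ => ⟨bot_le, fun _ => 1, fun _ => 0, ?_⟩, ?_⟩, ?_, rfl⟩
    · intro u v
      simp
    · have : Nonempty (Fin d) := ⟨⟨0, hd⟩⟩
      simp
    · rintro ⟨f⟩
      have h := f.toHom.map_adj (v := Sum.inl (⟨0, hk⟩ : Fin k))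
        (w := Sum.inr (⟨0, hk⟩ : Fin k)) (by simp)
      exact h
  exact ⟨Nat.sSup_mem hne hfin.bddAbove, fun e he => le_csSup hfin.bddAbove he⟩

/-!
By `isChainPow_iff`, a graph in `Chain^d` is the incidence graph of a family of octants
`{x | r u ≤ x}` and a family of points `p v` in `ℝ ^ d`, where `≤` is the coordinatewise order.

*Upper bound for `d = 3`.* Call an incidence `(u, v)` dominated in the direction `i` if the octant
`u` contains at least `k` points that are weakly above `v` in the two coordinates other than `i`.
For fixed `v` and `i` there are fewer than `k` such `u` (`card_dominated_le`): of `k` such octants,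
take the one with the largest `i`-th coordinate; the `k` points that witness domination in it lie
in all the others too, which makes a `K_{k,k}`. So at most `3 n (k - 1)` incidences are dominated in
some direction. On the other hand, if `g` points of an octant `u` are dominated in no direction,
then `g ≤ 6 (k - 1)` (`card_undominated_le`): any two points of `ℝ ^ 3` are comparable in two of the
three coordinates, so that each of the `g ^ 2` ordered pairs, in one of its two orders, is among
the at most `3 g (k - 1)` pairs `(v, w)` with `w` above `v` in some projection. Together this gives
`9 n (k - 1)`.

*Lower bound for `d = 4`.* Take as points the words of length `t` over `Fin b`, and as octants the
axis-parallel lines of this grid. Two points lie on at most one common line, and each point is on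
`t` lines. A line is described by a prefix and a suffix of its words, that is, by an interval of
the lexicographic order and an interval of the lexicographic order of the reversed words; so four
linear orders suffice (`exists_forall_le_iff_contains`). Replacing every vertex by `q = k - 1`
copies turns this `K_{2,2}`-free graph into a `K_{k,k}`-free one with `q ^ 2 t b ^ t` edges
(`sq_mul_ncard_le_chainZarankiewicz`). With `t` maximal such that `t ^ t ≤ n / q` and then `b`
maximal such that `b ^ t ≤ n / q`, one has `t ≤ b`, so there are at most `b ^ t` lines; moreover
`b ^ t ≥ n / (6 q)` and `t ≥ log n / (4 log log n)` for large `n`.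
-/

/-! ### Intersections of chain graphs as dominance graphs -/

theorem isChainGraph_iff_le {U V : Type*} {G : SimpleGraph (U ⊕ V)} :
    IsChainGraph G ↔ G ≤ completeBipartiteGraph U V ∧
      ∃ (r : U → ℝ) (p : V → ℝ), ∀ u v, G.Adj (Sum.inl u) (Sum.inr v) ↔ r u ≤ p v := by
  simp [IsChainGraph, Set.inter_singleton_nonempty]

/-- The bipartite graph of a relation `I` between `U` and `V`. -/
def bipartiteGraphOf {U V : Type*} (I : U → V → Prop) : SimpleGraph (U ⊕ V) where
  Adj
    | .inl u, .inr v => I u v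
    | .inr v, .inl u => I u v
    | _, _ => False
  symm := ⟨by rintro (u | v) (u' | v') h <;> exact h⟩
  loopless := ⟨by rintro (u | v) h <;> exact h⟩

@[simp] theorem bipartiteGraphOf_adj_inl_inr {U V : Type*} {I : U → V → Prop} {u : U} {v : V} :
    (bipartiteGraphOf I).Adj (.inl u) (.inr v) ↔ I u v := Iff.rfl

@[simp] theorem bipartiteGraphOf_adj_inr_inl {U V : Type*} {I : U → V → Prop} {u : U} {v : V} :
    (bipartiteGraphOf I).Adj (.inr v) (.inl u) ↔ I u v := Iff.rfl

@[simp] theorem bipartiteGraphOf_adj_inl_inl {U V : Type*} {I : U → V → Prop} {u u' : U} :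
    ¬ (bipartiteGraphOf I).Adj (.inl u) (.inl u') := id

@[simp] theorem bipartiteGraphOf_adj_inr_inr {U V : Type*} {I : U → V → Prop} {v v' : V} :
    ¬ (bipartiteGraphOf I).Adj (.inr v) (.inr v') := id

theorem bipartiteGraphOf_le_completeBipartiteGraph {U V : Type*} (I : U → V → Prop) :
    bipartiteGraphOf I ≤ completeBipartiteGraph U V := by
  rintro (u | v) (u' | v') h <;> simp_all

theorem eq_bipartiteGraphOf {U V : Type*} {G : SimpleGraph (U ⊕ V)}
    (hG : G ≤ completeBipartiteGraph U V) :
    G = bipartiteGraphOf fun u v => G.Adj (.inl u) (.inr v) := by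
  ext (u | v) (u' | v')
  · simpa using fun h => by simpa using hG h
  · simp
  · simp [G.adj_comm]
  · simpa using fun h => by simpa using hG h

/-- For `d ≥ 1`, the `d`-fold intersections of chain graphs are the dominance graphs of two point
sets in `ℝ ^ d`. -/
theorem isChainPow_iff {U V : Type*} {d : ℕ} (hd : 1 ≤ d) {G : SimpleGraph (U ⊕ V)} :
    IsChainPow d G ↔ ∃ (r : Fin d → U → ℝ) (p : Fin d → V → ℝ),
      G = bipartiteGraphOf fun u v => ∀ i, r i u ≤ p i v := by
  constructor
  · rintro ⟨H, hH, rfl⟩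
    simp only [isChainGraph_iff_le] at hH
    choose hle r p h using hH
    refine ⟨r, p, ?_⟩
    rw [eq_bipartiteGraphOf (G := ⨅ i, H i) ((iInf_le _ ⟨0, hd⟩).trans (hle _))]
    simp [SimpleGraph.iInf_adj, h]
  · rintro ⟨r, p, rfl⟩
    refine ⟨fun i => bipartiteGraphOf fun u v => r i u ≤ p i v, fun i => ?_, ?_⟩
    · exact isChainGraph_iff_le.2
        ⟨bipartiteGraphOf_le_completeBipartiteGraph _, r i, p i, fun _ _ => Iff.rfl⟩
    · have : Nonempty (Fin d) := ⟨⟨0, hd⟩⟩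
      ext (u | v) (u' | v') <;> simp [SimpleGraph.iInf_adj]

theorem ncard_edgeSet_bipartiteGraphOf {U V : Type*} (I : U → V → Prop) :
    (bipartiteGraphOf I).edgeSet.ncard = {e : U × V | I e.1 e.2}.ncard := by
  have h : (bipartiteGraphOf I).edgeSet =
      (fun e : U × V => s(Sum.inl e.1, Sum.inr e.2)) '' {e : U × V | I e.1 e.2} := by
    ext e
    induction e with | _ x y
    rcases x with u | v <;> rcases y with u' | v' <;> simp
  rw [h, Set.ncard_image_of_injective]
  rintro ⟨u, v⟩ ⟨u', v'⟩ h
  simpa using h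

/-- A bipartite graph without `K_{k,k}` as a subgraph is one whose relation contains no
combinatorial rectangle `S × T` with `|S| = |T| = k`. For `k = 0` both sides are
false. -/
theorem completeBipartiteGraph_free_iff {U V : Type*} {I : U → V → Prop} {k : ℕ} :
    (completeBipartiteGraph (Fin k) (Fin k)).Free (bipartiteGraphOf I) ↔
      ∀ (f : Fin k ↪ U) (g : Fin k ↪ V), ∃ i j, ¬ I (f i) (g j) := by
  constructor
  · intro h f g
    by_contra! hI
    refine h ⟨⟨⟨Sum.map f g, ?_⟩, f.injective.sumMap g.injective⟩⟩
    rintro (i | i) (j | j) hij <;> simp_all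
  · rintro h ⟨φ⟩
    have key : ∀ x y, (completeBipartiteGraph (Fin k) (Fin k)).Adj x y →
        (bipartiteGraphOf I).Adj (φ x) (φ y) := fun x y => φ.toHom.map_adj
    have hadj : ∀ i j, (bipartiteGraphOf I).Adj (φ (.inl i)) (φ (.inr j)) :=
      fun i j => key _ _ (by simp)
    rcases Nat.eq_zero_or_pos k with rfl | hk
    · obtain ⟨i, -⟩ := h ⟨Fin.elim0, fun i => i.elim0⟩ ⟨Fin.elim0, fun i => i.elim0⟩
      exact i.elim0
    let z : Fin k := ⟨0, hk⟩
    have hinj := φ.injective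
    rcases hz : φ (.inl z) with u | v
    · have hr : ∀ j, ∃ v, φ (.inr j) = .inr v := fun j => by
        have := hadj z j
        rcases hj : φ (.inr j) with u' | v' <;> simp_all
      choose g hg using hr
      have hl : ∀ i, ∃ u, φ (.inl i) = .inl u := fun i => by
        have := hadj i z
        rcases hj : φ (.inl i) with u' | v' <;> simp_all
      choose f hf using hl
      obtain ⟨i, j, hij⟩ := h ⟨f, fun i i' e => by
          simpa using hinj ((hf i).trans ((congrArg _ e).trans (hf i').symm))⟩
        ⟨g, fun i i' e => by
          simpa using hinj ((hg i).trans ((congrArg _ e).trans (hg i').symm))⟩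
      have := hadj i j
      rw [hf, hg] at this
      exact hij this
    · have hr : ∀ j, ∃ u, φ (.inr j) = .inl u := fun j => by
        have := hadj z j
        rcases hj : φ (.inr j) with u' | v' <;> simp_all
      choose g hg using hr
      have hl : ∀ i, ∃ v, φ (.inl i) = .inr v := fun i => by
        have := hadj i z
        rcases hj : φ (.inl i) with u' | v' <;> simp_all
      choose f hf using hl
      obtain ⟨i, j, hij⟩ := h ⟨g, fun i i' e => by
          simpa using hinj ((hg i).trans ((congrArg _ e).trans (hg i').symm))⟩
        ⟨f, fun i i' e => by
          simpa using hinj ((hf i).trans ((congrArg _ e).trans (hf i').symm))⟩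
      have := hadj j i
      rw [hf, hg] at this
      exact hij this

/-! ### The linear upper bound in dimension three -/

section Upper
open Finset Classical

/-- Of three comparisons, two go in the same direction; so any two points of `ℝ ^ 3` become
comparable after a suitable coordinate is dropped. -/
theorem exists_forall_ne_le_or (x y : Fin 3 → ℝ) :
    ∃ i, (∀ j ≠ i, x j ≤ y j) ∨ (∀ j ≠ i, y j ≤ x j) := by
  have h0 := le_total (x 0) (y 0)
  have h1 := le_total (x 1) (y 1)
  have h2 := le_total (x 2) (y 2)
  simp only [Fin.exists_fin_succ, Fin.forall_fin_succ]
  simp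
  tauto

/-- For a point `v` and a direction `i`, fewer than `k` of the octants `u ∋ v` contain `k` points
that lie weakly above `v` in the two coordinates other than `i`. -/
theorem card_dominated_le {U V : Type*} [Fintype U] [Fintype V] {k : ℕ} {r : Fin 3 → U → ℝ}
    {p : Fin 3 → V → ℝ}
    (h : ∀ (f : Fin k ↪ U) (g : Fin k ↪ V), ∃ a b, ¬ ∀ i, r i (f a) ≤ p i (g b))
    (i : Fin 3) (v : V) :
    #{u | (∀ j, r j u ≤ p j v) ∧
      k ≤ #{w | (∀ j, r j u ≤ p j w) ∧ ∀ j ≠ i, p j v ≤ p j w}} ≤ k - 1 := by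
  set S := ({u | (∀ j, r j u ≤ p j v) ∧
      k ≤ #{w | (∀ j, r j u ≤ p j w) ∧ ∀ j ≠ i, p j v ≤ p j w}} : Finset U) with hS
  by_contra! hcard
  have hk : k ≤ #S := by omega
  have hne : S.Nonempty := card_pos.1 (by omega)
  -- the neighbours of the dominated `u` with the largest `i`-th coordinate lie above all of `S`
  obtain ⟨u, hu, hmax⟩ := S.exists_max_image (r i) hne
  have hu' := (mem_filter.1 hu).2.2
  obtain ⟨S', hS', hS'k⟩ := exists_subset_card_eq hk
  obtain ⟨T', hT', hT'k⟩ := exists_subset_card_eq hu'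
  obtain ⟨a, b, hab⟩ := h ((S'.equivFinOfCardEq hS'k).symm.toEmbedding.trans
    (Function.Embedding.subtype _)) ((T'.equivFinOfCardEq hT'k).symm.toEmbedding.trans
    (Function.Embedding.subtype _))
  refine hab fun j => ?_
  have hx := hS' ((S'.equivFinOfCardEq hS'k).symm a).2
  have hy := (mem_filter.1 (hT' ((T'.equivFinOfCardEq hT'k).symm b).2)).2
  rcases eq_or_ne j i with rfl | hj
  · exact (hmax _ hx).trans (hy.1 j)
  · exact ((mem_filter.1 hx).2.1 j).trans (hy.2 j hj)

/-- Among the points of an octant, at most `6 * (k - 1)` have fewer than `k` points weakly above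
them in each of the three coordinate projections to the plane. The reason is a double count of the
ordered pairs of such points, each of which is comparable in some projection. -/
theorem card_undominated_le {V : Type*} [Fintype V] {k : ℕ} {p : Fin 3 → V → ℝ} (N : Finset V) :
    #{v ∈ N | ∀ i, #{w ∈ N | ∀ j ≠ i, p j v ≤ p j w} ≤ k - 1} ≤ 6 * (k - 1) := by
  set g := ({v ∈ N | ∀ i, #{w ∈ N | ∀ j ≠ i, p j v ≤ p j w} ≤ k - 1} : Finset V) with hg
  have hrow : ∀ v ∈ g, #{w ∈ g | ∃ i, ∀ j ≠ i, p j v ≤ p j w} ≤ 3 * (k - 1) := fun v hv =>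
    calc #{w ∈ g | ∃ i, ∀ j ≠ i, p j v ≤ p j w}
        ≤ #(univ.biUnion fun i : Fin 3 => {w ∈ N | ∀ j ≠ i, p j v ≤ p j w}) := by
          refine card_le_card fun w hw => ?_
          obtain ⟨hw, i, hi⟩ := mem_filter.1 hw
          exact mem_biUnion.2 ⟨i, mem_univ _, mem_filter.2 ⟨(mem_filter.1 hw).1, hi⟩⟩
      _ ≤ ∑ i : Fin 3, #{w ∈ N | ∀ j ≠ i, p j v ≤ p j w} := card_biUnion_le
      _ ≤ ∑ i : Fin 3, (k - 1) := sum_le_sum fun i _ => (mem_filter.1 hv).2 i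
      _ = 3 * (k - 1) := by simp
  set R := ({e ∈ g ×ˢ g | ∃ i, ∀ j ≠ i, p j e.1 ≤ p j e.2} : Finset (V × V)) with hR
  have hRcard : #R ≤ #g * (3 * (k - 1)) := by
    rw [hR, card_filter, sum_product, ← smul_eq_mul, ← sum_const]
    refine sum_le_sum fun v hv => ?_
    rw [← card_filter]
    exact hrow v hv
  have hcover : g ×ˢ g ⊆ R ∪ R.image Prod.swap := by
    rintro ⟨v, w⟩ hvw
    obtain ⟨hv, hw⟩ := mem_product.1 hvw
    rw [mem_union, mem_image]
    obtain ⟨i, hi | hi⟩ := exists_forall_ne_le_or (fun j => p j v) (fun j => p j w)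
    · exact Or.inl (mem_filter.2 ⟨hvw, i, hi⟩)
    · exact Or.inr ⟨(w, v), mem_filter.2 ⟨mem_product.2 ⟨hw, hv⟩, i, hi⟩, rfl⟩
  have hsq : #g * #g ≤ #g * (6 * (k - 1)) :=
    calc #g * #g = #(g ×ˢ g) := (card_product _ _).symm
      _ ≤ #R + #(R.image Prod.swap) := (card_le_card hcover).trans (card_union_le _ _)
      _ ≤ #R + #R := by exact Nat.add_le_add_left card_image_le _
      _ ≤ #g * (3 * (k - 1)) + #g * (3 * (k - 1)) := by gcongr
      _ = #g * (6 * (k - 1)) := by ring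
  rcases Nat.eq_zero_or_pos #g with h0 | h0
  · omega
  · exact Nat.le_of_mul_le_mul_left hsq h0

theorem card_dominance_pairs_le {U V : Type*} [Fintype U] [Fintype V] {k : ℕ}
    {r : Fin 3 → U → ℝ} {p : Fin 3 → V → ℝ}
    (h : ∀ (f : Fin k ↪ U) (g : Fin k ↪ V), ∃ a b, ¬ ∀ i, r i (f a) ≤ p i (g b)) :
    #{e : U × V | ∀ i, r i e.1 ≤ p i e.2} ≤
      3 * (k - 1) * Fintype.card V + 6 * (k - 1) * Fintype.card U := by
  set D : Fin 3 → Finset (U × V) := fun i => {e | (∀ j, r j e.1 ≤ p j e.2) ∧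
    k ≤ #{w | (∀ j, r j e.1 ≤ p j w) ∧ ∀ j ≠ i, p j e.2 ≤ p j w}} with hD
  set N : U → Finset V := fun u => {v | ∀ j, r j u ≤ p j v} with hN
  set F : Finset (U × V) := {e | e.2 ∈ N e.1 ∧
    ∀ i, #{w ∈ N e.1 | ∀ j ≠ i, p j e.2 ≤ p j w} ≤ k - 1} with hF
  have hcover : ({e : U × V | ∀ i, r i e.1 ≤ p i e.2} : Finset (U × V)) ⊆
      univ.biUnion D ∪ F := by
    intro e he
    have he' := (mem_filter.1 he).2
    simp only [mem_union, mem_biUnion, hD, hF, hN, mem_filter, mem_univ, true_and, filter_filter]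
    by_cases hi : ∃ i, k ≤ #{w | (∀ j, r j e.1 ≤ p j w) ∧ ∀ j ≠ i, p j e.2 ≤ p j w}
    · exact Or.inl (hi.imp fun i hi => ⟨he', hi⟩)
    · push Not at hi
      exact Or.inr ⟨he', fun i => Nat.le_sub_one_of_lt (hi i)⟩
  have hDcard : ∀ i, #(D i) ≤ (k - 1) * Fintype.card V := fun i => by
    rw [hD, card_filter, Fintype.sum_prod_type_right, mul_comm, ← card_univ, ← smul_eq_mul,
      ← sum_const]
    refine sum_le_sum fun v _ => ?_
    rw [← card_filter]
    exact card_dominated_le h i v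
  have hFcard : #F ≤ 6 * (k - 1) * Fintype.card U := by
    rw [hF, card_filter, Fintype.sum_prod_type, mul_comm, ← card_univ, ← smul_eq_mul, ← sum_const]
    refine sum_le_sum fun u _ => ?_
    rw [← card_filter]
    exact (card_le_card fun v hv => mem_filter.2 (mem_filter.1 hv).2).trans
      (card_undominated_le (k := k) (p := p) (N u))
  calc _ ≤ #(univ.biUnion D) + #F := (card_le_card hcover).trans (card_union_le _ _)
    _ ≤ ∑ i, #(D i) + #F := by gcongr; exact card_biUnion_le
    _ ≤ ∑ _i : Fin 3, (k - 1) * Fintype.card V + 6 * (k - 1) * Fintype.card U := by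
        gcongr with i; exact hDcard i
    _ = _ := by simp; ring

end Upper

theorem chainZarankiewicz_three_le {k : ℕ} (hk : 1 ≤ k) (n m : ℕ) :
    chainZarankiewicz 3 n m k ≤ 3 * (k - 1) * m + 6 * (k - 1) * n := by
  obtain ⟨G, hG, hfree, he⟩ := (chainZarankiewicz_isGreatest (d := 3) (by norm_num) hk n m).1
  obtain ⟨r, p, rfl⟩ := (isChainPow_iff (by norm_num)).1 hG
  rw [← he, ncard_edgeSet_bipartiteGraphOf, Set.ncard_eq_toFinset_card']
  have := card_dominance_pairs_le (completeBipartiteGraph_free_iff.1 hfree)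
  simp only [Fintype.card_fin] at this
  convert this using 2
  ext
  simp

/-! ### Blowing up a graph without `K_{2,2}` -/

theorem exists_ne_of_forall_mem_fiber {A X : Type*} {q : ℕ} (e : A × Fin q ↪ X)
    (f : Fin (q + 1) ↪ X) (a : Fin (q + 1) → A) (h : ∀ i, ∃ j, e (a i, j) = f i) :
    ∃ i i', a i ≠ a i' := by
  by_contra! hconst
  choose j hj using h
  obtain ⟨i, i', hne, heq⟩ := Fintype.exists_ne_map_eq_of_card_lt j (by simp)
  exact hne (f.injective (by rw [← hj, ← hj, hconst i i', heq]))

open Classical in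
/-- Replacing every vertex of a `K_{2,2}`-free dominance graph by `q` copies of itself yields a
`K_{q+1,q+1}`-free one; vertices that are in excess are made isolated. -/
theorem sq_mul_ncard_le_chainZarankiewicz {A B : Type*} [Fintype A] [Fintype B] {d n m q : ℕ}
    (hd : 1 ≤ d) {r : Fin d → A → ℝ} {p : Fin d → B → ℝ}
    (hfree : ∀ a a' b b', (∀ i, r i a ≤ p i b) → (∀ i, r i a ≤ p i b') → (∀ i, r i a' ≤ p i b) →
      (∀ i, r i a' ≤ p i b') → a = a' ∨ b = b')
    (hA : Fintype.card A * q ≤ n) (hB : Fintype.card B * q ≤ m) :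
    q ^ 2 * {e : A × B | ∀ i, r i e.1 ≤ p i e.2}.ncard ≤ chainZarankiewicz d n m (q + 1) := by
  obtain ⟨eA⟩ : Nonempty (A × Fin q ↪ Fin n) := Function.Embedding.nonempty_of_card_le (by simpa)
  obtain ⟨eB⟩ : Nonempty (B × Fin q ↪ Fin m) := Function.Embedding.nonempty_of_card_le (by simpa)
  let α : Fin n → Option A := fun x => (Function.partialInv eA x).map Prod.fst
  let β : Fin m → Option B := fun y => (Function.partialInv eB y).map Prod.fst
  have hα : ∀ a j, α (eA (a, j)) = some a := fun a j => by
    simp [α, Function.partialInv_left eA.injective]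
  have hβ : ∀ b j, β (eB (b, j)) = some b := fun b j => by
    simp [β, Function.partialInv_left eB.injective]
  have hα' : ∀ x a, α x = some a → ∃ j, eA (a, j) = x := fun x a h => by
    obtain ⟨⟨a', j⟩, h', rfl⟩ := Option.map_eq_some_iff.1 h
    exact ⟨j, (eA.injective.isPartialInv _ _).1 h'⟩
  have hβ' : ∀ y b, β y = some b → ∃ j, eB (b, j) = y := fun y b h => by
    obtain ⟨⟨b', j⟩, h', rfl⟩ := Option.map_eq_some_iff.1 h
    exact ⟨j, (eB.injective.isPartialInv _ _).1 h'⟩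
  -- `M` and `-M` are the coordinates of the isolated rays and of the isolated points
  obtain ⟨M, hM, hrM, hpM⟩ : ∃ M : ℝ, 0 < M ∧ (∀ i a, -M < r i a) ∧ ∀ i b, p i b < M := by
    obtain ⟨M₁, h₁⟩ := (Set.finite_range fun x : Fin d × A => |r x.1 x.2|).bddAbove
    obtain ⟨M₂, h₂⟩ := (Set.finite_range fun x : Fin d × B => |p x.1 x.2|).bddAbove
    refine ⟨max 0 (max M₁ M₂) + 1, by positivity, fun i a => ?_, fun i b => ?_⟩
    · have := neg_le_of_abs_le (h₁ ⟨(i, a), rfl⟩)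
      linarith [le_max_right 0 (max M₁ M₂), le_max_left M₁ M₂]
    · have := le_of_abs_le (h₂ ⟨(i, b), rfl⟩)
      linarith [le_max_right 0 (max M₁ M₂), le_max_right M₁ M₂]
  let r' : Fin d → Fin n → ℝ := fun i x => (α x).elim M (r i)
  let p' : Fin d → Fin m → ℝ := fun i y => (β y).elim (-M) (p i)
  let I : Fin n → Fin m → Prop := fun x y => ∀ i, r' i x ≤ p' i y
  have hI : ∀ x y, I x y ↔ ∃ a b, α x = some a ∧ β y = some b ∧ ∀ i, r i a ≤ p i b := by
    intro x y
    let z : Fin d := ⟨0, hd⟩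
    rcases hx : α x with _ | a <;> rcases hy : β y with _ | b <;>
      simp only [I, r', p', hx, hy, Option.elim]
    · simpa using ⟨⟨z⟩, by linarith⟩
    · simpa using ⟨z, hpM z b⟩
    · simpa using ⟨z, hrM z a⟩
    · simp
  have hmem : (bipartiteGraphOf I).edgeSet.ncard ∈ chainEdgeCounts d n m (q + 1) := by
    refine ⟨_, (isChainPow_iff hd).2 ⟨r', p', rfl⟩, ?_, rfl⟩
    rw [completeBipartiteGraph_free_iff]
    intro f g
    by_contra! hfg
    replace hfg := fun i j => (hI (f i) (g j)).1 (hfg i j)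
    have ha : ∀ i, ∃ a, α (f i) = some a := fun i => (hfg i 0).imp fun a h => h.choose_spec.1
    have hb : ∀ j, ∃ b, β (g j) = some b := fun j => by
      obtain ⟨a, b, -, h, -⟩ := hfg 0 j
      exact ⟨b, h⟩
    choose a ha using ha
    choose b hb using hb
    have hab : ∀ i j l, r l (a i) ≤ p l (b j) := fun i j => by
      obtain ⟨a', b', h₁, h₂, h⟩ := hfg i j
      rw [ha, Option.some_inj] at h₁
      rw [hb, Option.some_inj] at h₂
      rwa [h₁, h₂]
    obtain ⟨i, i', hi⟩ := exists_ne_of_forall_mem_fiber eA f a fun i => hα' _ _ (ha i)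
    obtain ⟨j, j', hj⟩ := exists_ne_of_forall_mem_fiber eB g b fun j => hβ' _ _ (hb j)
    exact (hfree _ _ _ _ (hab i j) (hab i j') (hab i' j) (hab i' j')).elim hi hj
  refine le_trans ?_ ((chainZarankiewicz_isGreatest hd (by omega) n m).2 hmem)
  rw [ncard_edgeSet_bipartiteGraphOf]
  calc q ^ 2 * {e : A × B | ∀ i, r i e.1 ≤ p i e.2}.ncard
      = ({e : A × B | ∀ i, r i e.1 ≤ p i e.2} ×ˢ (Set.univ : Set (Fin q × Fin q))).ncard := by
        rw [Set.ncard_prod, Set.ncard_univ, Nat.card_eq_fintype_card]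
        simp [sq, mul_comm]
    _ ≤ _ := by
        refine Set.ncard_le_ncard_of_injOn
          (fun x => (eA (x.1.1, x.2.1), eB (x.1.2, x.2.2))) ?_ ?_ (Set.toFinite _)
        · rintro ⟨⟨a, b⟩, j, j'⟩ ⟨h, -⟩
          exact (hI _ _).2 ⟨a, b, hα _ _, hβ _ _, h⟩
        · rintro ⟨⟨a, b⟩, j, j'⟩ - ⟨⟨a₁, b₁⟩, j₁, j₁'⟩ - h
          simp only [Prod.mk.injEq, EmbeddingLike.apply_eq_iff_eq] at h ⊢
          tauto

/-! ### Points and lines of a grid have Ferrers dimension at most four -/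

/-- The words that agree with `w` before the position `s` form an interval of the lexicographic
order. -/
theorem toLex_le_and_le_toLex_iff {ι β : Type*} [LinearOrder ι] [WellFoundedLT ι] [LinearOrder β]
    [BoundedOrder β] (w a : ι → β) (s : ι) :
    toLex (fun i => if i < s then w i else ⊥) ≤ toLex a ∧
      toLex a ≤ toLex (fun i => if i < s then w i else ⊤) ↔ ∀ i < s, a i = w i := by
  constructor
  · rintro ⟨h₁, h₂⟩ i
    -- the first position at which `a` and `w` differ decides both comparisons
    induction i using WellFoundedLT.induction with | _ i ih
    intro hi
    by_contra hne
    rcases lt_or_gt_of_ne hne with hlt | hlt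
    · refine h₁.not_gt ⟨i, fun j hj => ?_, ?_⟩
      · simp [hj.trans hi, ih j hj (hj.trans hi)]
      · simpa [hi] using hlt
    · refine h₂.not_gt ⟨i, fun j hj => ?_, ?_⟩
      · simp [hj.trans hi, ih j hj (hj.trans hi)]
      · simpa [hi] using hlt
  · refine fun h => ⟨Pi.toLex_monotone fun i => ?_, Pi.toLex_monotone fun i => ?_⟩
    · by_cases hi : i < s <;> simp [hi, h]
    · by_cases hi : i < s <;> simp [hi, h]

/-- The axis-parallel lines of the grid `Fin b ^ Fin t`: a direction, and the values of the
coordinates that are constant along the line. -/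
abbrev GridLine (t b : ℕ) : Type := Σ s : Fin t, ({i : Fin t // i ≠ s} → Fin b)

theorem card_gridLine (t b : ℕ) : Fintype.card (GridLine t b) = t * b ^ (t - 1) := by
  simp [GridLine, Fintype.card_subtype_compl]

/-- Incidence of a line and a point of the grid. -/
def GridLine.Contains {t b : ℕ} (l : GridLine t b) (a : Fin t → Fin b) : Prop :=
  ∀ i (h : i ≠ l.1), a i = l.2 ⟨i, h⟩

theorem GridLine.eq_or_eq_of_contains {t b : ℕ} {l l' : GridLine t b} {a a' : Fin t → Fin b}
    (h₁ : l.Contains a) (h₂ : l.Contains a') (h₃ : l'.Contains a) (h₄ : l'.Contains a') :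
    l = l' ∨ a = a' := by
  obtain ⟨s, w⟩ := l
  obtain ⟨s', w'⟩ := l'
  by_cases hs : s = s'
  · subst hs
    left
    congr
    ext ⟨i, hi⟩
    exact congrArg Fin.val ((h₁ i hi).symm.trans (h₃ i hi))
  · right
    ext i
    by_cases hi : i = s
    · subst hi
      rw [h₃ i hs, h₄ i hs]
    · rw [h₁ i hi, h₂ i hi]

theorem mul_pow_le_ncard_contains (t b : ℕ) :
    t * b ^ t ≤ {e : GridLine t b × (Fin t → Fin b) | e.1.Contains e.2}.ncard := by
  have h := Set.ncard_le_ncard_of_injOn (s := (Set.univ : Set (Fin t × (Fin t → Fin b))))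
    (t := {e : GridLine t b × (Fin t → Fin b) | e.1.Contains e.2})
    (fun x => (⟨x.1, fun i => x.2 i⟩, x.2)) (fun x _ i _ => rfl) ?_ (Set.toFinite _)
  · simpa [Set.ncard_univ, Nat.card_eq_fintype_card] using h
  · rintro ⟨s, a⟩ - ⟨s', a'⟩ - h
    simp only [Prod.mk.injEq, Sigma.mk.injEq] at h ⊢
    exact ⟨h.1.1, h.2⟩

/-- A line in direction `s` is the set of words with a given prefix before `s` and a given suffix
after `s`. Reading the words from the left and from the right, these are two interval conditions,
hence four inequalities. -/
theorem exists_forall_le_iff_contains (t b : ℕ) [NeZero b] :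
    ∃ (r : Fin 4 → GridLine t b → ℝ) (p : Fin 4 → (Fin t → Fin b) → ℝ),
      ∀ l a, (∀ i, r i l ≤ p i a) ↔ l.Contains a := by
  obtain ⟨φ⟩ := Order.embedding_from_countable_to_dense (Lex (Fin t → Fin b)) ℝ
  obtain ⟨ψ⟩ := Order.embedding_from_countable_to_dense (Lex ((Fin t)ᵒᵈ → Fin b)) ℝ
  let w : GridLine t b → Fin t → Fin b := fun l i => if h : i ≠ l.1 then l.2 ⟨i, h⟩ else ⊥
  refine ⟨![fun l => φ (toLex fun i => if i < l.1 then w l i else ⊥),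
      fun l => -φ (toLex fun i => if i < l.1 then w l i else ⊤),
      fun l => ψ (toLex fun i => if i < .toDual l.1 then w l i.ofDual else ⊥),
      fun l => -ψ (toLex fun i => if i < .toDual l.1 then w l i.ofDual else ⊤)],
    ![fun a => φ (toLex a), fun a => -φ (toLex a), fun a => ψ (toLex fun i => a i.ofDual),
      fun a => -ψ (toLex fun i => a i.ofDual)], fun l a => ?_⟩
  have h₁ := toLex_le_and_le_toLex_iff (w l) a l.1
  have h₂ := toLex_le_and_le_toLex_iff (fun i : (Fin t)ᵒᵈ => w l i.ofDual) (fun i => a i.ofDual)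
    (.toDual l.1)
  have hw : ∀ i (hi : i ≠ l.1), w l i = l.2 ⟨i, hi⟩ := fun i hi => dif_pos hi
  trans (∀ i < l.1, a i = w l i) ∧ ∀ i : (Fin t)ᵒᵈ, i < .toDual l.1 → a i.ofDual = w l i.ofDual
  · rw [← h₁, ← h₂]
    simp [Fin.forall_fin_succ, and_assoc]
  · constructor
    · rintro ⟨h, h'⟩ i hi
      rcases lt_or_gt_of_ne hi with hlt | hlt
      · rw [h i hlt, hw i hi]
      · rw [← hw i hi]
        exact h' (.toDual i) hlt
    · refine fun h => ⟨fun i hi => ?_, fun i hi => ?_⟩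
      · rw [h i hi.ne, hw i hi.ne]
      · have hi' : i.ofDual ≠ l.1 := fun e => hi.ne (congrArg OrderDual.toDual e)
        rw [h _ hi', hw _ hi']

theorem sq_mul_pow_le_chainZarankiewicz_four {t b q n : ℕ} (ht : 1 ≤ t) (htb : t ≤ b)
    (hn : b ^ t * q ≤ n) : q ^ 2 * (t * b ^ t) ≤ chainZarankiewicz 4 n n (q + 1) := by
  have : NeZero b := ⟨by omega⟩
  obtain ⟨r, p, h⟩ := exists_forall_le_iff_contains t b
  have hlines : t * b ^ (t - 1) ≤ b ^ t := by
    obtain ⟨t, rfl⟩ := Nat.exists_eq_add_of_le' ht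
    rw [pow_succ', Nat.add_sub_cancel]
    gcongr
  have key := sq_mul_ncard_le_chainZarankiewicz (n := n) (m := n) (q := q) (by norm_num)
    (r := r) (p := p) (fun l l' a a' => by
      simp only [h]
      exact GridLine.eq_or_eq_of_contains)
    (by rw [card_gridLine]; exact (Nat.mul_le_mul_right q hlines).trans hn) (by simpa using hn)
  simp only [h] at key
  exact (Nat.mul_le_mul_left _ (mul_pow_le_ncard_contains t b)).trans key

/-! ### Choice of the length and the alphabet of the words -/

theorem exists_le_lt_succ {f : ℕ → ℕ} {N m : ℕ} (h1 : f 1 ≤ N) (hm : N < f (m + 1)) :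
    ∃ t, 1 ≤ t ∧ f t ≤ N ∧ N < f (t + 1) := by
  classical
  have hex : ∃ m, N < f (m + 1) := ⟨m, hm⟩
  rcases ht : Nat.find hex with _ | t
  · have := Nat.find_spec hex
    rw [ht] at this
    exact absurd h1 this.not_ge
  · refine ⟨t + 1, by omega, ?_, by simpa [ht] using Nat.find_spec hex⟩
    exact not_lt.1 (Nat.find_min hex (m := t) (by omega))

theorem add_one_pow_le_three_mul_pow {t b : ℕ} (ht : 1 ≤ t) (htb : t ≤ b) :
    ((b : ℝ) + 1) ^ t ≤ 3 * (b : ℝ) ^ t := by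
  have hb : (0 : ℝ) < b := by exact_mod_cast ht.trans htb
  calc ((b : ℝ) + 1) ^ t = ((b : ℝ)⁻¹ + 1) ^ t * (b : ℝ) ^ t := by
        rw [← mul_pow]
        congr 1
        field_simp
        ring
    _ ≤ Real.exp (b : ℝ)⁻¹ ^ t * (b : ℝ) ^ t := by
        gcongr
        exact Real.add_one_le_exp _
    _ = Real.exp (t * (b : ℝ)⁻¹) * (b : ℝ) ^ t := by rw [Real.exp_nat_mul]
    _ ≤ Real.exp 1 * (b : ℝ) ^ t := by
        gcongr
        rw [← div_eq_mul_inv, div_le_one hb]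
        exact_mod_cast htb
    _ ≤ 3 * (b : ℝ) ^ t := by
        gcongr
        linarith [Real.exp_one_lt_d9]

theorem div_log_le_of_le_mul_log {L x : ℝ} (hx : 0 < x) (hL : 1 ≤ Real.log L)
    (h : L ≤ 2 * (x * Real.log x)) : L / Real.log L ≤ 2 * x := by
  have h0 : 0 < Real.log L := by linarith
  by_contra! hlt
  rw [lt_div_iff₀ h0] at hlt
  have hxL : x ≤ L := by nlinarith
  have : x * Real.log x ≤ x * Real.log L := by gcongr
  linarith

theorem mul_log_div_log_log_le_chainZarankiewicz {q n : ℕ} (hq : 1 ≤ q) (hn : 4 * q ^ 2 ≤ n)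
    (hlog : 1 ≤ Real.log (Real.log n)) :
    1 / 48 * ((n : ℝ) * (q + 1) * (Real.log n / Real.log (Real.log n))) ≤
      chainZarankiewicz 4 n n (q + 1) := by
  have hN1 : 1 ≤ n / q := (Nat.one_le_div_iff hq).2 (by nlinarith)
  have hNn : n / q * q ≤ n := Nat.div_mul_le_self n q
  have hnN : n ≤ 2 * q * (n / q) := by
    have := Nat.lt_mul_div_succ n hq
    nlinarith
  generalize n / q = N at hN1 hNn hnN
  -- since `4 q ^ 2 ≤ n`, passing from `n` to `N = n / q` costs at most a factor 2 in the logarithm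
  have hnN2 : n ≤ N ^ 2 := by
    by_contra! hlt
    nlinarith [Nat.mul_le_mul hnN hnN, Nat.mul_le_mul_right (N ^ 2) hn,
      Nat.mul_lt_mul_of_pos_left hlt (show 0 < n by nlinarith)]
  obtain ⟨t, ht1, htN, hNt⟩ := exists_le_lt_succ (f := fun t => t ^ t) (N := N) (m := N)
    (by simpa using hN1) (Nat.lt_of_succ_le (Nat.le_self_pow (by omega) _))
  obtain ⟨b, hb1, hbN, hNb⟩ := exists_le_lt_succ (f := fun b => b ^ t) (N := N) (m := N)
    (by simpa using hN1) (Nat.lt_of_succ_le (Nat.le_self_pow (by omega) _))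
  -- `t ≤ b` bounds the number of lines, and makes `(b + 1) ^ t` comparable to `b ^ t`
  have htb : t ≤ b := by
    by_contra! hlt
    exact (hNb.trans_le (Nat.pow_le_pow_left hlt t)).not_ge htN
  have hlow := sq_mul_pow_le_chainZarankiewicz_four (q := q) (n := n) ht1 htb
    ((Nat.mul_le_mul_right q hbN).trans hNn)
  have hlow' : (q : ℝ) ^ 2 * (t * (b : ℝ) ^ t) ≤ chainZarankiewicz 4 n n (q + 1) := by
    exact_mod_cast hlow
  have hq' : (1 : ℝ) ≤ q := by exact_mod_cast hq
  have ht' : (1 : ℝ) ≤ t := by exact_mod_cast ht1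
  have hNb' : (N : ℝ) ≤ 3 * (b : ℝ) ^ t := by
    refine le_trans ?_ (add_one_pow_le_three_mul_pow ht1 htb)
    exact_mod_cast hNb.le
  have hnN' : (n : ℝ) ≤ 2 * q * N := by exact_mod_cast hnN
  have hn0 : (0 : ℝ) < n := by
    have : 0 < n := by nlinarith
    exact_mod_cast this
  have hlogn : Real.log n ≤ 2 * (((t : ℝ) + 1) * Real.log ((t : ℝ) + 1)) :=
    calc Real.log n ≤ Real.log ((N : ℝ) ^ 2) := Real.log_le_log hn0 (by exact_mod_cast hnN2)
      _ ≤ Real.log ((((t : ℝ) + 1) ^ (t + 1)) ^ 2) := by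
          refine Real.log_le_log (by positivity) ?_
          gcongr
          exact_mod_cast hNt.le
      _ = _ := by
          rw [Real.log_pow, Real.log_pow]
          push_cast
          ring
  have hfrac : Real.log n / Real.log (Real.log n) ≤ 4 * t :=
    (div_log_le_of_le_mul_log (by positivity) hlog hlogn).trans (by linarith)
  calc 1 / 48 * ((n : ℝ) * (q + 1) * (Real.log n / Real.log (Real.log n)))
      ≤ 1 / 48 * ((2 * q * (3 * (b : ℝ) ^ t)) * (q + q) * (4 * t)) := by
        gcongr
        exact hnN'.trans (by gcongr)
    _ = (q : ℝ) ^ 2 * (t * (b : ℝ) ^ t) := by ring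
    _ ≤ _ := hlow'

theorem theorem1 :
    (∀ k : ℕ, 1 ≤ k → ∀ n : ℕ,
      (chainZarankiewicz 3 n n k : ℝ) ≤ 9 * (n : ℝ) * ((k : ℝ) - 1)) ∧
    (∃ c : ℝ, 0 < c ∧ ∀ k : ℕ, 2 ≤ k → ∀ᶠ n : ℕ in Filter.atTop,
      c * ((n : ℝ) * (k : ℝ) * (Real.log (n : ℝ) / Real.log (Real.log (n : ℝ)))) ≤
        (chainZarankiewicz 4 n n k : ℝ)) := by
  refine ⟨fun k hk n => ?_, 1 / 48, by norm_num, fun k hk => ?_⟩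
  · obtain ⟨k, rfl⟩ := Nat.exists_eq_add_of_le' hk
    have h : (chainZarankiewicz 3 n n (k + 1) : ℝ) ≤ 3 * k * n + 6 * k * n := by
      exact_mod_cast chainZarankiewicz_three_le hk n n
    push_cast
    linarith
  · obtain ⟨q, rfl⟩ := Nat.exists_eq_add_of_le' (show 1 ≤ k by omega)
    have hlog := (Real.tendsto_log_atTop.comp
      (Real.tendsto_log_atTop.comp tendsto_natCast_atTop_atTop)).eventually_ge_atTop 1
    filter_upwards [Filter.eventually_ge_atTop (4 * q ^ 2), hlog] with n hn hlogn
    push_cast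
    exact mul_log_div_log_log_le_chainZarankiewicz (by omega) hn hlogn
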